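/- For real numbers $a<1$ and $b>1$ with $ab>1$, the Takagi function is $T_{a,b}(x)=\sum_{n=0}^{\infty}a^nT(b^nx)$, where $T:\mathbb{R}\to\mathbb{R}$ is the tent map: $T$ has period $1$, $T(x)=x$ on $[0,\tfrac12]$ and $T(x)=1-x$ on $[\tfrac12,1]$. Let $\Gamma_{T_{a,b}}=\{(x,y)\in\mathbb{R}^2: x\in[0,1],\ y=T_{a,b}(x)\}$ be its graph over $[0,1]$. For $F\subset\mathbb{R}^2$ let $N_r(F)$ be the least number of closed Euclidean balls of radius $r$ covering $F$, let $$\dim_{\mathrm A}F=\inf\Big\{s\ge 0:\ \exists C>0\ \forall R>0\ \forall r\in(0,R)\ \forall x\in F,\ N_r(B(x,R)\cap F)\le C\,(R/r)^s\Big\}$$ be the Assouad dimension, where $B(x,R)$ is the closed ball of centre $x$ and radius $R$, and let $\overline{\dim}_{\mathrm B}F=\limsup_{r\to0^+}\frac{\log N_r(F)}{-\log r}$ be the upper box dimension. A Littlewood polynomial of degree $k-1$ is a polynomial $\sum_{n=0}^{k-1}\epsilon_nx^n$ with $\epsilon_n\in\{-1,1\}$ for all $0\le n\le k-1$. Theorem.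 Let $\beta>1$ be a root of a Littlewood polynomial of degree $k-1$, $k\ge1$. (1) If $a<1$ is real, $b>2$ is an integer and $ab=\beta$, then $$\dim_{\mathrm A}\Gamma_{T_{a,b}}\ \ge\ 1+\frac1k ,\qquad \overline{\dim}_{\mathrm B}\Gamma_{T_{a,b}}=1+\frac{\ln(ab)}{\ln b}.$$ (2) There is $b_0$, depending on $\beta$ and $k$, such that for every integer $b\ge b_0$ and every real $a<1$ with $ab=\beta$, $$\overline{\dim}_{\mathrm B}\Gamma_{T_{a,b}}<1+\frac1k .$$ -/

import Mathlib

open Filter Topology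

noncomputable section

/-- The tent map: the function of period `1` on `ℝ` equal to `x` on `[0, 1/2]` and to `1 - x` on
`[1/2, 1]`. -/
def tent (x : ℝ) : ℝ := min (Int.fract x) (1 - Int.fract x)

/-- The Takagi function `T_{a,b}(x) = ∑ aⁿ T(bⁿ x)`, where `T` is the tent map. The series converges
absolutely when `|a| < 1`. -/
def takagi (a b x : ℝ) : ℝ := ∑' n : ℕ, a ^ n * tent (b ^ n * x)

/-- The graph of `f` over `[0, 1]`, as a subset of the Euclidean plane. -/
def graphOnUnit (f : ℝ → ℝ) : Set (EuclideanSpace ℝ (Fin 2)) :=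
  {p | p 0 ∈ Set.Icc (0 : ℝ) 1 ∧ p 1 = f (p 0)}

/-- A Littlewood polynomial: all coefficients up to the degree are `1` or `-1` (in particular the
polynomial is nonzero). -/
def IsLittlewood (p : Polynomial ℤ) : Prop :=
  ∀ i ≤ p.natDegree, p.coeff i = 1 ∨ p.coeff i = -1

/-- `N_r(F)`: the smallest number of closed balls of radius `r`, with centres anywhere in the
space, that cover `F` (`⊤` if no finite number does). -/
def ballCount {X : Type*} [PseudoMetricSpace X] (r : ℝ) (F : Set X) : ENNReal :=
  (Metric.externalCoveringNumber r.toNNReal F : ENNReal)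

/-- `s` is an admissible exponent in the definition of the Assouad dimension of `F`. -/
def IsAssouadExponent {X : Type*} [PseudoMetricSpace X] (F : Set X) (s : ℝ) : Prop :=
  ∃ C : ℝ, 0 < C ∧ ∀ R : ℝ, 0 < R → ∀ r : ℝ, 0 < r → r < R → ∀ x ∈ F,
    ballCount r (Metric.closedBall x R ∩ F) ≤ ENNReal.ofReal (C * (R / r) ^ s)

/-- The Assouad dimension: the infimum of the admissible exponents `s ≥ 0` (`⊤` if there are
none). -/
def assouadDim {X : Type*} [PseudoMetricSpace X] (F : Set X) : EReal :=
  ⨅ (s : ℝ) (_ : 0 ≤ s ∧ IsAssouadExponent F s), (s : EReal)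

/-- The upper box dimension: the upper limit of `log N_r(F) / (- log r)` as `r` tends to `0` from
the right. -/
def upperBoxDim {X : Type*} [PseudoMetricSpace X] (F : Set X) : EReal :=
  limsup (fun r : ℝ => ENNReal.log (ballCount r F) / ((-Real.log r : ℝ) : EReal)) (𝓝[>] 0)

end

/-! Split the series after `n` terms: `takagi_eq_partial_add` writes the function as a piecewise
affine partial sum plus `a ^ n` times the function itself at `b ^ n * x`. The `i`-th term has slope
`± (a * b) ^ i`, the sign being the parity of a half-cell index, and for `b ≥ 2` every half-cell has
children of both parities, so any sign sequence starting with `1` is realised on nested half-cells.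

Assouad dimension: when `a * b` is a root of a Littlewood polynomial of degree `k - 1`, the signs
can be its coefficients, and the partial sum of `k` terms is constant on some half-cell of
generation `k - 1`. Its `b` children carry rescaled copies of the graph with a common base height
(`exists_isCopyOn`). Iterating gives `b ^ n` such copies in generation `k * n`
(`exists_family_isCopyOn`). Inside a sufficiently deep copy of width comparable to `R` these become
`b ^ n` columns of width comparable to `r = R / b ^ (k * n)`, each of which the graph crosses
through the same height `R / 2`, because vertical scales shrink more slowly than horizontal ones. An
area estimate then forces at least a constant times `b ^ n * (R / r) = (R / r) ^ (1 + 1 / k)` balls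
(`exists_ball_count`).

Box dimension: on an interval of length `b ^ (-n)` the oscillation is comparable to `a ^ n`, so
covering at that scale takes about `b ^ n * (a * b) ^ n` balls (`upperBoxDim_takagi`). With `a * b =
β` fixed, the resulting value is below `1 + 1 / k` exactly when `b > β ^ k`. -/

/-! ### The tent map. -/

theorem tent_eq_abs_sub_round (x : ℝ) : tent x = |x - round x| :=
  (abs_sub_round_eq_min x).symm

theorem tent_nonneg (x : ℝ) : 0 ≤ tent x := by
  rw [tent_eq_abs_sub_round]; exact abs_nonneg _

theorem tent_le_half (x : ℝ) : tent x ≤ 1 / 2 := by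
  rw [tent_eq_abs_sub_round]; exact abs_sub_round x

theorem tent_le_abs_sub_int (x : ℝ) (z : ℤ) : tent x ≤ |x - z| := by
  rw [tent_eq_abs_sub_round]; exact round_le x z

theorem tent_sub_le (x y : ℝ) : tent x - tent y ≤ |x - y| := by
  have h := tent_le_abs_sub_int x (round y)
  rw [tent_eq_abs_sub_round y]
  have := abs_sub_le x y (round y : ℝ)
  linarith

theorem abs_tent_sub_le (x y : ℝ) : |tent x - tent y| ≤ |x - y| := by
  rw [abs_le]
  have h1 := tent_sub_le x y
  have h2 := tent_sub_le y x
  rw [abs_sub_comm] at h2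
  constructor <;> linarith

theorem continuous_tent : Continuous tent :=
  (LipschitzWith.of_dist_le_mul (K := 1) fun x y => by
    simpa [Real.dist_eq] using abs_tent_sub_le x y).continuous

theorem tent_add_int (x : ℝ) (z : ℤ) : tent (x + z) = tent x := by simp [tent]

theorem tent_neg (x : ℝ) : tent (-x) = tent x := by
  apply le_antisymm
  · have := tent_le_abs_sub_int (-x) (-round x)
    rw [tent_eq_abs_sub_round x, abs_sub_comm]
    push_cast at this
    rwa [show -x - -(round x : ℝ) = round x - x by ring] at this
  · have := tent_le_abs_sub_int x (-round (-x))
    rw [tent_eq_abs_sub_round (-x), abs_sub_comm]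
    push_cast at this
    rwa [show x - -(round (-x) : ℝ) = round (-x) - -x by ring] at this

theorem tent_of_mem_Icc {u : ℝ} (h0 : 0 ≤ u) (h1 : u ≤ 1 / 2) : tent u = u := by
  have : Int.fract u = u := Int.fract_eq_self.2 ⟨h0, by linarith⟩
  rw [tent, this, min_eq_left]; linarith

theorem tent_of_even {j : ℕ} (hj : Even j) {x : ℝ} (h0 : (j : ℝ) / 2 ≤ x)
    (h1 : x ≤ (j + 1 : ℝ) / 2) : tent x = x - j / 2 := by
  obtain ⟨m, rfl⟩ := hj
  push_cast at *
  have h := tent_add_int (x - (m + m) / 2) m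
  rw [show x - ((m : ℝ) + m) / 2 + ((m : ℤ) : ℝ) = x by push_cast; ring] at h
  rw [h, tent_of_mem_Icc] <;> linarith

theorem tent_of_odd {j : ℕ} (hj : Odd j) {x : ℝ} (h0 : (j : ℝ) / 2 ≤ x)
    (h1 : x ≤ (j + 1 : ℝ) / 2) : tent x = (j + 1) / 2 - x := by
  obtain ⟨m, rfl⟩ := hj
  push_cast at *
  have h := tent_add_int (x - (m + 1)) (m + 1)
  rw [show x - ((m : ℝ) + 1) + ((m + 1 : ℤ) : ℝ) = x by push_cast; ring] at h
  rw [h, ← tent_neg, tent_of_mem_Icc] <;> linarith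

theorem tent_nat (m : ℕ) : tent m = 0 := by simp [tent]

theorem tent_nat_add_half (m : ℕ) : tent (m + 1 / 2) = 1 / 2 := by
  have h := tent_add_int (1 / 2) m
  rw [tent_of_mem_Icc (by norm_num) le_rfl] at h
  rw [add_comm]; exact_mod_cast h

/-! ### The Takagi series: self-affinity, symmetries and modulus of continuity. -/

/-- The `n`-th partial sum of the Takagi series. -/
noncomputable def takagiPartial (a b : ℝ) (n : ℕ) (x : ℝ) : ℝ :=
  ∑ m ∈ Finset.range n, a ^ m * tent (b ^ m * x)

theorem takagi_term_le {a : ℝ} (h0 : 0 ≤ a) (b x : ℝ) (n : ℕ) :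
    ‖a ^ n * tent (b ^ n * x)‖ ≤ a ^ n := by
  have h1 := tent_nonneg (b ^ n * x)
  have h2 := tent_le_half (b ^ n * x)
  have h3 := pow_nonneg h0 n
  rw [Real.norm_of_nonneg (mul_nonneg h3 h1)]
  nlinarith

theorem takagi_summable {a : ℝ} (h0 : 0 ≤ a) (h1 : a < 1) (b x : ℝ) :
    Summable fun n : ℕ => a ^ n * tent (b ^ n * x) :=
  .of_norm_bounded (summable_geometric_of_lt_one h0 h1) (takagi_term_le h0 b x)

theorem continuous_takagi {a : ℝ} (h0 : 0 ≤ a) (h1 : a < 1) (b : ℝ) : Continuous (takagi a b) :=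
  continuous_tsum (fun n => continuous_const.mul (continuous_tent.comp (by fun_prop)))
    (summable_geometric_of_lt_one h0 h1) (fun n x => takagi_term_le h0 b x n)

theorem takagi_nonneg {a : ℝ} (h0 : 0 ≤ a) (b x : ℝ) : 0 ≤ takagi a b x :=
  tsum_nonneg fun n => mul_nonneg (pow_nonneg h0 n) (tent_nonneg _)

theorem takagi_le {a : ℝ} (h0 : 0 ≤ a) (h1 : a < 1) (b x : ℝ) : takagi a b x ≤ (1 - a)⁻¹ := by
  rw [← tsum_geometric_of_lt_one h0 h1]
  exact (takagi_summable h0 h1 b x).tsum_le_tsum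
    (fun n => (le_abs_self _).trans (takagi_term_le h0 b x n))
    (summable_geometric_of_lt_one h0 h1)

theorem takagi_eq_partial_add {a : ℝ} (h0 : 0 ≤ a) (h1 : a < 1) (b x : ℝ) (n : ℕ) :
    takagi a b x = takagiPartial a b n x + a ^ n * takagi a b (b ^ n * x) := by
  rw [takagi, ← (takagi_summable h0 h1 b x).sum_add_tsum_nat_add n, takagiPartial, takagi,
    ← tsum_mul_left]
  congr 2
  funext m
  rw [← mul_assoc, ← mul_assoc, ← pow_add, ← pow_add, add_comm n m]

theorem takagi_nat (a : ℝ) (b m : ℕ) : takagi a b m = 0 := by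
  have h (n : ℕ) : a ^ n * tent ((b : ℝ) ^ n * m) = 0 := by
    rw [show (b : ℝ) ^ n * m = ((b ^ n * m : ℕ) : ℝ) by push_cast; rfl, tent_nat, mul_zero]
  simp [takagi, h]

theorem half_le_takagi {a : ℝ} (h0 : 0 ≤ a) (h1 : a < 1) (b : ℝ) (m : ℕ) :
    1 / 2 ≤ takagi a b (m + 1 / 2) := by
  have h := takagi_eq_partial_add h0 h1 b (m + 1 / 2) 1
  simp only [takagiPartial, Finset.range_one, Finset.sum_singleton, pow_zero, one_mul,
    tent_nat_add_half] at h
  have := mul_nonneg (pow_nonneg h0 1) (takagi_nonneg h0 b (b ^ 1 * (m + 1 / 2)))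
  linarith

theorem takagi_nat_add (a : ℝ) (b m : ℕ) (x : ℝ) : takagi a b (m + x) = takagi a b x := by
  unfold takagi
  congr 1
  funext n
  rw [show (b : ℝ) ^ n * (m + x) = b ^ n * x + ((b ^ n * m : ℤ) : ℝ) by push_cast; ring,
    tent_add_int]

theorem takagi_neg (a b x : ℝ) : takagi a b (-x) = takagi a b x := by
  simp only [takagi, mul_neg, tent_neg]

theorem abs_takagiPartial_sub_le {a : ℝ} (h0 : 0 ≤ a) {b : ℝ} (hb : 0 ≤ b) (n : ℕ) (x y : ℝ) :
    |takagiPartial a b n x - takagiPartial a b n y|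
      ≤ (∑ m ∈ Finset.range n, (a * b) ^ m) * |x - y| := by
  rw [takagiPartial, takagiPartial, ← Finset.sum_sub_distrib, Finset.sum_mul]
  refine (Finset.abs_sum_le_sum_abs _ _).trans (Finset.sum_le_sum fun m _ => ?_)
  rw [← mul_sub, abs_mul, abs_of_nonneg (pow_nonneg h0 m), mul_pow, mul_assoc]
  refine mul_le_mul_of_nonneg_left ((abs_tent_sub_le _ _).trans_eq ?_) (pow_nonneg h0 m)
  rw [← mul_sub, abs_mul, abs_of_nonneg (pow_nonneg hb m)]

/-- The partial sum has Lipschitz constant at most a geometric sum, which is of order `(a * b) ^ n`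
since `a * b > 1`; the remainder is `a ^ n` times a function with values in `[0, (1 - a)⁻¹]`. -/
theorem abs_takagi_sub_le {a : ℝ} (h0 : 0 ≤ a) (h1 : a < 1) {b : ℝ} (hb : 0 < b)
    (hab : 1 < a * b) (n : ℕ) {x y : ℝ} (hxy : |x - y| ≤ (b ^ n)⁻¹) :
    |takagi a b x - takagi a b y| ≤ ((a * b - 1)⁻¹ + (1 - a)⁻¹) * a ^ n := by
  rw [takagi_eq_partial_add h0 h1 b x n, takagi_eq_partial_add h0 h1 b y n]
  have hS := abs_takagiPartial_sub_le h0 hb.le n x y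
  have hgeom : ∑ m ∈ Finset.range n, (a * b) ^ m ≤ (a * b) ^ n * (a * b - 1)⁻¹ := by
    rw [geom_sum_eq hab.ne', div_eq_mul_inv]
    exact mul_le_mul_of_nonneg_right (by linarith) (inv_nonneg.2 (by linarith))
  have hS' : (∑ m ∈ Finset.range n, (a * b) ^ m) * |x - y| ≤ (a * b - 1)⁻¹ * a ^ n := by
    have hi : 0 ≤ (a * b - 1)⁻¹ := inv_nonneg.2 (by linarith)
    calc _ ≤ ((a * b) ^ n * (a * b - 1)⁻¹) * (b ^ n)⁻¹ := by
          apply mul_le_mul hgeom hxy (abs_nonneg _); positivity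
      _ = _ := by rw [mul_pow]; field_simp
  have hT : |takagi a b (b ^ n * x) - takagi a b (b ^ n * y)| ≤ (1 - a)⁻¹ := by
    have := takagi_nonneg h0 b (b ^ n * x)
    have := takagi_nonneg h0 b (b ^ n * y)
    have := takagi_le h0 h1 b (b ^ n * x)
    have := takagi_le h0 h1 b (b ^ n * y)
    rw [abs_le]; constructor <;> linarith
  rw [add_sub_add_comm, ← mul_sub]
  refine (abs_add_le _ _).trans ?_
  rw [abs_mul, abs_of_nonneg (pow_nonneg h0 n), add_mul]
  refine add_le_add (hS.trans hS') ?_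
  rw [mul_comm]
  exact mul_le_mul_of_nonneg_right hT (pow_nonneg h0 n)

/-! ### Half-cells and the slopes of partial sums. -/

/-- The `j`-th interval of length `b ^ (-m) / 2`. -/
def halfCell (b m j : ℕ) : Set ℝ := {x | (b : ℝ) ^ m * x ∈ Set.Icc ((j : ℝ) / 2) ((j + 1 : ℝ) / 2)}

theorem halfCell_subset {b : ℕ} (hb : 0 < b) (m : ℕ) {m' j r : ℕ} (hr : r < b ^ m') :
    halfCell b (m + m') (j * b ^ m' + r) ⊆ halfCell b m j := by
  rintro x ⟨h0, h1⟩
  have hB : (0 : ℝ) < (b : ℝ) ^ m' := by positivity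
  have hr' : (r : ℝ) + 1 ≤ (b : ℝ) ^ m' := by exact_mod_cast hr
  have hr0 : (0 : ℝ) ≤ r := r.cast_nonneg
  push_cast at h0 h1
  rw [pow_add] at h0 h1
  constructor
  · refine le_of_mul_le_mul_left ?_ hB
    linarith
  · refine le_of_mul_le_mul_left ?_ hB
    linarith

theorem halfCell_subset_Icc {b : ℕ} (hb : 0 < b) {m j : ℕ} (hj : j < b ^ m) :
    halfCell b m j ⊆ Set.Icc 0 1 := by
  intro x hx
  have h := halfCell_subset hb 0 (m' := m) (j := 0) (r := j) hj (by simpa using hx)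
  simp only [halfCell, Set.mem_ofPred_eq, pow_zero, one_mul, Nat.cast_zero, Set.mem_Icc] at h
  constructor <;> linarith [h.1, h.2]

theorem exists_tent_eq_add (j : ℕ) :
    ∃ d : ℝ, ∀ x ∈ Set.Icc ((j : ℝ) / 2) ((j + 1 : ℝ) / 2), tent x = d + (-1) ^ j * x := by
  rcases Nat.even_or_odd j with h | h
  · refine ⟨-(j / 2), fun x hx => ?_⟩
    rw [tent_of_even h hx.1 hx.2, h.neg_one_pow]; ring
  · refine ⟨(j + 1) / 2, fun x hx => ?_⟩
    rw [tent_of_odd h hx.1 hx.2, h.neg_one_pow]; ring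

theorem takagiPartial_affine_zero (a : ℝ) (b j : ℕ) :
    ∃ d : ℝ, ∀ x ∈ halfCell b 0 j, takagiPartial a b 1 x = d + (-1) ^ j * x := by
  obtain ⟨d, hd⟩ := exists_tent_eq_add j
  refine ⟨d, fun x hx => ?_⟩
  simp only [halfCell, pow_zero, one_mul, Set.mem_ofPred_eq] at hx
  simp [takagiPartial, hd x hx]

theorem takagiPartial_affine_succ {a : ℝ} {b : ℕ} (hb : 0 < b) {m j r : ℕ} (hr : r < b) {d s : ℝ}
    (h : ∀ x ∈ halfCell b m j, takagiPartial a b (m + 1) x = d + s * x) :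
    ∃ d' : ℝ, ∀ x ∈ halfCell b (m + 1) (j * b + r),
      takagiPartial a b (m + 1 + 1) x = d' + (s + (-1) ^ (j * b + r) * (a * b) ^ (m + 1)) * x := by
  obtain ⟨d', hd'⟩ := exists_tent_eq_add (j * b + r)
  refine ⟨d + a ^ (m + 1) * d', fun x hx => ?_⟩
  have hx' : x ∈ halfCell b m j :=
    halfCell_subset hb m (m' := 1) (j := j) (r := r) (by simpa using hr) (by simpa using hx)
  rw [takagiPartial, Finset.sum_range_succ, ← takagiPartial, h x hx', hd' _ hx, mul_pow]
  ring

theorem takagiPartial_affine (a : ℝ) {b : ℕ} (hb : 0 < b) (m j : ℕ) :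
    ∃ d s : ℝ, ∀ x ∈ halfCell b m j, takagiPartial a b (m + 1) x = d + s * x := by
  induction m generalizing j with
  | zero =>
    obtain ⟨d, hd⟩ := takagiPartial_affine_zero a b j
    exact ⟨d, _, hd⟩
  | succ m ih =>
    obtain ⟨d, s, h⟩ := ih (j / b)
    obtain ⟨d', h'⟩ := takagiPartial_affine_succ hb (Nat.mod_lt j hb) h
    rw [Nat.div_add_mod'] at h'
    exact ⟨d', _, h'⟩

/-- Every sequence of signs is the sequence of signs of the slopes of the terms of the Takagi series
on a nested sequence of intervals. -/
theorem exists_takagiPartial_slope (a : ℝ) {b : ℕ} (hb : 2 ≤ b) {ε : ℕ → ℝ} (h0 : ε 0 = 1)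
    (hε : ∀ i, ε i = 1 ∨ ε i = -1) (m : ℕ) :
    ∃ j < b ^ m, (-1) ^ j = ε m ∧ ∃ d : ℝ, ∀ x ∈ halfCell b m j,
      takagiPartial a b (m + 1) x = d + (∑ i ∈ Finset.range (m + 1), ε i * (a * b) ^ i) * x := by
  induction m with
  | zero =>
    obtain ⟨d, hd⟩ := takagiPartial_affine_zero a b 0
    exact ⟨0, by simp, by simp [h0], d, by simpa [h0] using hd⟩
  | succ m ih =>
    obtain ⟨j, hj, -, d, hd⟩ := ih
    -- The first two children have opposite parities, so one of them has the wanted sign.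
    obtain ⟨r, hr, hsign⟩ : ∃ r < 2, (-1 : ℝ) ^ (j * b + r) = ε (m + 1) := by
      rcases neg_one_pow_eq_or ℝ (j * b) with h | h <;> rcases hε (m + 1) with h' | h'
      · exact ⟨0, by norm_num, by simp [h, h']⟩
      · exact ⟨1, by norm_num, by simp [pow_succ, h, h']⟩
      · exact ⟨1, by norm_num, by simp [pow_succ, h, h']⟩
      · exact ⟨0, by norm_num, by simp [h, h']⟩
    obtain ⟨d', hd'⟩ := takagiPartial_affine_succ (by omega) (hr.trans_le hb) hd
    refine ⟨j * b + r, ?_, hsign, d', fun x hx => ?_⟩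
    · rw [pow_succ]
      nlinarith
    · rw [hd' x hx, hsign, Finset.sum_range_succ _ (m + 1)]

/-! ### Rescaled copies of the graph at a common height. -/

/-- Over the cell `halfCell b m j` the Takagi graph is a rescaled copy of the whole graph, with base
at height `c`. -/
def IsCopyOn (a : ℝ) (b m : ℕ) (c : ℝ) (j : ℕ) : Prop :=
  ∀ x ∈ halfCell b m j, takagi a b x = c + a ^ m * takagi a b ((b : ℝ) ^ m * x)

/-- The vanishing sum is the slope of the partial sum on one half-cell of generation `m`; its `b`
children form `J`, and `c` is the constant value there. -/
theorem exists_isCopyOn {a : ℝ} (h0 : 0 ≤ a) (h1 : a < 1) {b : ℕ} (hb : 2 ≤ b) {ε : ℕ → ℝ}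
    (hε0 : ε 0 = 1) (hε : ∀ i, ε i = 1 ∨ ε i = -1) {m : ℕ}
    (hsum : ∑ i ∈ Finset.range (m + 1), ε i * (a * b) ^ i = 0) :
    ∃ (c : ℝ) (J : Finset ℕ), J.card = b ∧ ∀ j ∈ J, j < b ^ (m + 1) ∧ IsCopyOn a b (m + 1) c j := by
  obtain ⟨j, hj, -, d, hd⟩ := exists_takagiPartial_slope a hb hε0 hε m
  refine ⟨d, (Finset.range b).image (j * b + ·), ?_, fun i hi => ?_⟩
  · rw [Finset.card_image_of_injective _ (add_right_injective _), Finset.card_range]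
  · obtain ⟨r, hr, rfl⟩ := Finset.mem_image.1 hi
    rw [Finset.mem_range] at hr
    refine ⟨by rw [pow_succ]; nlinarith, fun x hx => ?_⟩
    have hx' : x ∈ halfCell b m j :=
      halfCell_subset (by omega) m (m' := 1) (j := j) (r := r) (by simpa using hr)
        (by simpa using hx)
    rw [takagi_eq_partial_add h0 h1 b x (m + 1), hd x hx', hsum, zero_mul, add_zero]

/-- The index of the cell in which the `i`-th subcell of the cell `j` sits, subcells being counted
from the left or from the right according to the slope of the tent map. -/
def subcell (B j i : ℕ) : ℕ := j * B + if Even j then i else B - 1 - i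

theorem exists_subcell_eq {B j i : ℕ} (hi : i < B) : ∃ r < B, subcell B j i = j * B + r := by
  unfold subcell
  split_ifs
  · exact ⟨i, hi, rfl⟩
  · exact ⟨B - 1 - i, by omega, rfl⟩

theorem subcell_injOn {B j j' i i' : ℕ} (hi : i < B) (hi' : i' < B)
    (h : subcell B j i = subcell B j' i') : j = j' ∧ i = i' := by
  have hdiv {j i : ℕ} (hi : i < B) : subcell B j i / B = j := by
    obtain ⟨r, hr, h⟩ := exists_subcell_eq (j := j) hi
    rw [h, mul_comm, Nat.mul_add_div (by omega), Nat.div_eq_of_lt hr, add_zero]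
  have hj : j = j' := by rw [← hdiv (j := j) hi, h, hdiv hi']
  subst hj
  refine ⟨rfl, ?_⟩
  unfold subcell at h
  split_ifs at h <;> omega

/-- By periodicity and evenness, the function on `[j / 2, (j + 1) / 2]` is a translate of that on
`[0, 1 / 2]` for even `j` and a reflection of it for odd `j`; `subcell` numbers the children
accordingly. -/
theorem IsCopyOn.comp {a : ℝ} {b m m' j i : ℕ} {c c' : ℝ} (hb : 0 < b) (h : IsCopyOn a b m c j)
    (h' : IsCopyOn a b m' c' i) (hi : i < b ^ m') :
    IsCopyOn a b (m + m') (c + a ^ m * c') (subcell (b ^ m') j i) := by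
  intro x hx
  obtain ⟨r, hr, hr'⟩ := exists_subcell_eq (j := j) hi
  have hxj : x ∈ halfCell b m j := halfCell_subset hb m hr (hr' ▸ hx)
  rw [h x hxj]
  obtain ⟨hx0, hx1⟩ := hx
  have hpow : (b : ℝ) ^ (m + m') * x = (b : ℝ) ^ m' * ((b : ℝ) ^ m * x) := by ring
  rw [hpow] at hx0 hx1 ⊢
  set y : ℝ := (b : ℝ) ^ m * x
  suffices hy : takagi a b y = c' + a ^ m' * takagi a b ((b : ℝ) ^ m' * y) by
    rw [hy]; ring
  rcases Nat.even_or_odd j with hj | hj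
  · simp only [subcell, if_pos hj] at hx0 hx1
    obtain ⟨l, rfl⟩ := hj
    push_cast at hx0 hx1
    have hu := h' (y - l) ⟨by linarith, by linarith⟩
    rw [show y = l + (y - l) by ring, takagi_nat_add, hu, mul_add]
    have := takagi_nat_add a b (b ^ m' * l) ((b : ℝ) ^ m' * (y - l))
    push_cast at this
    rw [this]
  · simp only [subcell, if_neg (Nat.not_even_iff_odd.2 hj)] at hx0 hx1
    obtain ⟨l, rfl⟩ := hj
    have hcast : ((b ^ m' - 1 - i : ℕ) : ℝ) = (b : ℝ) ^ m' - 1 - i := by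
      rw [Nat.cast_sub (by omega), Nat.cast_sub (by omega)]; push_cast; rfl
    push_cast [hcast] at hx0 hx1
    have hu := h' ((l + 1) - y) ⟨by linarith, by linarith⟩
    have hy := takagi_nat_add a b (l + 1) (-((l + 1) - y))
    have hz := takagi_nat_add a b (b ^ m' * (l + 1)) (-((b : ℝ) ^ m' * ((l + 1) - y)))
    rw [takagi_neg] at hy hz
    push_cast at hy hz
    rw [← hz, ← hy] at hu
    rw [show ((l : ℝ) + 1 + -(l + 1 - y)) = y by ring] at hu
    rw [hu]
    congr 3
    ring

/-- The height of a composed copy depends only on the heights of its two factors, so composing all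
pairs from two families of common height gives a family of common height. -/
theorem exists_family_isCopyOn {a : ℝ} {b m : ℕ} {c : ℝ} (hb : 0 < b) {J : Finset ℕ}
    (hcard : J.card = b) (hJ : ∀ j ∈ J, j < b ^ m ∧ IsCopyOn a b m c j) (n : ℕ) :
    ∃ (c' : ℝ) (J' : Finset ℕ), J'.card = b ^ n ∧
      ∀ j ∈ J', j < b ^ (m * n) ∧ IsCopyOn a b (m * n) c' j := by
  induction n with
  | zero => exact ⟨0, {0}, by simp, by simp [IsCopyOn]⟩
  | succ n ih =>
    obtain ⟨c', J', hcard', hJ'⟩ := ih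
    refine ⟨c' + a ^ (m * n) * c, (J' ×ˢ J).image fun p => subcell (b ^ m) p.1 p.2, ?_, ?_⟩
    · rw [Finset.card_image_of_injOn, Finset.card_product, hcard, hcard', pow_succ]
      rintro ⟨j, i⟩ hp ⟨j', i'⟩ hp' h
      simp only [Finset.coe_product, Set.mem_prod, Finset.mem_coe] at hp hp'
      obtain ⟨rfl, rfl⟩ := subcell_injOn (hJ i hp.2).1 (hJ i' hp'.2).1 h
      rfl
    · intro i hi
      obtain ⟨⟨j, i⟩, hp, rfl⟩ := Finset.mem_image.1 hi
      rw [Finset.mem_product] at hp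
      obtain ⟨hi0, hi⟩ := hJ i hp.2
      obtain ⟨hj0, hj⟩ := hJ' j hp.1
      refine ⟨?_, (hj.comp hb hi hi0 :)⟩
      obtain ⟨r, hr, h⟩ := exists_subcell_eq (j := j) hi0
      rw [h, mul_add, mul_one, pow_add]
      nlinarith

/-- One endpoint is an integer, with value `0`, and the other a half-integer, with value at least `1
/ 2`. -/
theorem exists_takagi_eq {a : ℝ} (h0 : 0 ≤ a) (h1 : a < 1) (b j : ℕ) {t : ℝ}
    (ht : t ∈ Set.Icc (0 : ℝ) (1 / 2)) :
    ∃ y ∈ Set.Icc ((j : ℝ) / 2) ((j + 1 : ℝ) / 2), takagi a b y = t := by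
  have hle : (j : ℝ) / 2 ≤ (j + 1 : ℝ) / 2 := by linarith
  have hc := (continuous_takagi h0 h1 b).continuousOn (s := Set.Icc ((j : ℝ) / 2) ((j + 1) / 2))
  rcases Nat.even_or_odd j with ⟨l, rfl⟩ | ⟨l, rfl⟩
  · refine intermediate_value_Icc hle hc ?_
    have hl := half_le_takagi h0 h1 b l
    push_cast
    rw [show ((l : ℝ) + l) / 2 = l by ring, takagi_nat,
      show ((l : ℝ) + l + 1) / 2 = l + 1 / 2 by ring]
    exact ⟨ht.1, ht.2.trans hl⟩
  · refine intermediate_value_Icc' hle hc ?_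
    have hl := half_le_takagi h0 h1 b l
    have hn := takagi_nat a b (l + 1)
    push_cast at hn ⊢
    rw [show (2 * (l : ℝ) + 1 + 1) / 2 = l + 1 by ring, hn,
      show (2 * (l : ℝ) + 1) / 2 = l + 1 / 2 by ring]
    exact ⟨ht.1, ht.2.trans hl⟩

theorem IsCopyOn.exists_eq {a : ℝ} (h0 : 0 < a) (h1 : a < 1) {b : ℕ} (hb : 0 < b) {m j : ℕ} {c : ℝ}
    (h : IsCopyOn a b m c j) {t : ℝ} (ht : t ∈ Set.Icc c (c + a ^ m / 2)) :
    ∃ x ∈ halfCell b m j, takagi a b x = t := by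
  have ha : 0 < a ^ m := by positivity
  obtain ⟨y, hy, hyt⟩ := exists_takagi_eq h0.le h1 b j (t := (t - c) / a ^ m)
    ⟨div_nonneg (by linarith [ht.1]) ha.le, by rw [div_le_iff₀ ha]; linarith [ht.2]⟩
  have hB : (b : ℝ) ^ m ≠ 0 := by positivity
  have hyx : (b : ℝ) ^ m * (y / (b : ℝ) ^ m) = y := by field_simp
  have hx : y / (b : ℝ) ^ m ∈ halfCell b m j := by rwa [halfCell, Set.mem_ofPred_eq, hyx]
  refine ⟨_, hx, ?_⟩
  rw [h _ hx, hyx, hyt]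
  field_simp
  ring

/-! ### Lower bounds for covering numbers by area. -/

theorem dist_le_add_abs (p q : EuclideanSpace ℝ (Fin 2)) :
    dist p q ≤ |p 0 - q 0| + |p 1 - q 1| := by
  rw [EuclideanSpace.dist_eq, Fin.sum_univ_two, Real.dist_eq, Real.dist_eq]
  apply Real.sqrt_le_iff.2 ⟨by positivity, ?_⟩
  nlinarith [mul_nonneg (abs_nonneg (p 0 - q 0)) (abs_nonneg (p 1 - q 1))]

theorem exists_isCover_encard_eq {X : Type*} [PseudoEMetricSpace X] (ε : NNReal) (F : Set X) :
    ∃ C : Set X, Metric.IsCover ε F C ∧ C.encard = Metric.externalCoveringNumber ε F := by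
  rw [Metric.externalCoveringNumber, iInf_subtype']
  have : Nonempty {C : Set X // Metric.IsCover ε F C} := ⟨⟨F, .rfl⟩⟩
  obtain ⟨C, hC⟩ := ciInf_mem fun C : {C : Set X // Metric.IsCover ε F C} => C.1.encard
  exact ⟨C.1, C.2, hC⟩

/-- Doubling the radii of the balls that cover `F` gives a cover of its `r`-neighbourhood, hence of
`E`. -/
theorem volume_le_ballCount_mul {r : ℝ} (hr : 0 < r) {E F : Set (EuclideanSpace ℝ (Fin 2))}
    (h : ∀ p ∈ E, ∃ q ∈ F, dist p q ≤ r) :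
    MeasureTheory.volume E ≤ ballCount r F *
      (ENNReal.ofReal ((2 * r) ^ 2) *
        MeasureTheory.volume (Metric.ball (0 : EuclideanSpace ℝ (Fin 2)) 1)) := by
  obtain ⟨C, hC, hcard⟩ := exists_isCover_encard_eq r.toNNReal F
  rw [ballCount, ← hcard]
  set K := ENNReal.ofReal ((2 * r) ^ 2) *
        MeasureTheory.volume (Metric.ball (0 : EuclideanSpace ℝ (Fin 2)) 1) with hK
  have hK0 : K ≠ 0 := by
    refine mul_ne_zero ?_ (Metric.measure_ball_pos _ _ one_pos).ne'
    rw [ENNReal.ofReal_ne_zero_iff]; positivity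
  by_cases hfin : C.Finite
  · have hsub : E ⊆ ⋃ c ∈ hfin.toFinset, Metric.closedBall c (2 * r) := by
      intro p hp
      obtain ⟨q, hq, hpq⟩ := h p hp
      have := Metric.isCover_iff_subset_iUnion_closedBall.1 hC hq
      simp only [Set.mem_iUnion, Metric.mem_closedBall, Real.coe_toNNReal r hr.le] at this
      obtain ⟨c, hc, hqc⟩ := this
      simp only [Set.mem_iUnion, Metric.mem_closedBall]
      exact ⟨c, by simpa using hc, by linarith [dist_triangle p q c]⟩
    refine (MeasureTheory.measure_mono hsub).trans
      ((MeasureTheory.measure_biUnion_finset_le _ _).trans_eq ?_)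
    have hball (c : EuclideanSpace ℝ (Fin 2)) :
        MeasureTheory.volume (Metric.closedBall c (2 * r)) = K := by
      rw [MeasureTheory.Measure.addHaar_closedBall _ _ (by positivity), finrank_euclideanSpace,
        Fintype.card_fin]
    simp_rw [hball]
    rw [Finset.sum_const, nsmul_eq_mul, hfin.encard_eq_coe_toFinset_card]
    simp
  · rw [Set.Infinite.encard_eq hfin, ENat.toENNReal_top, ENNReal.top_mul hK0]
    exact le_top

/-- The rectangle `[x, x + w) × [y, y + L]`. -/
def planeBox (x w y L : ℝ) : Set (EuclideanSpace ℝ (Fin 2)) :=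
  {p | p 0 ∈ Set.Ico x (x + w) ∧ p 1 ∈ Set.Icc y (y + L)}

theorem planeBox_eq_preimage (x w y L : ℝ) :
    planeBox x w y L =
      WithLp.ofLp ⁻¹' Set.univ.pi ![Set.Ico x (x + w), Set.Icc y (y + L)] := by
  ext p
  simp [planeBox, Set.mem_pi, Fin.forall_fin_two]

theorem measurableSet_pi_planeBox (x w y L : ℝ) :
    MeasurableSet (Set.univ.pi ![Set.Ico x (x + w), Set.Icc y (y + L)]) := by
  refine MeasurableSet.univ_pi fun i => ?_
  fin_cases i
  · exact measurableSet_Ico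
  · exact measurableSet_Icc

theorem measurableSet_planeBox (x w y L : ℝ) : MeasurableSet (planeBox x w y L) := by
  rw [planeBox_eq_preimage]
  exact (PiLp.volume_preserving_ofLp (Fin 2)).measurable (measurableSet_pi_planeBox x w y L)

theorem volume_planeBox {w : ℝ} (hw : 0 ≤ w) (x y L : ℝ) :
    MeasureTheory.volume (planeBox x w y L) = ENNReal.ofReal (w * L) := by
  rw [planeBox_eq_preimage, (PiLp.volume_preserving_ofLp (Fin 2)).measure_preimage
    (measurableSet_pi_planeBox x w y L).nullMeasurableSet, MeasureTheory.volume_pi_pi,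
    Fin.prod_univ_two]
  simp [ENNReal.ofReal_mul hw]

/-- If a plane set meets every horizontal line through each of several boxes standing on different
columns of width `w ≤ r`, then the number of `r`-balls needed to cover it is at least
the total area of the boxes, up to a factor `r ^ 2`. -/
theorem card_mul_le_ballCount_mul {r w L : ℝ} (hw : 0 < w) (hwr : w ≤ r)
    {F : Set (EuclideanSpace ℝ (Fin 2))} (s : Finset ℕ) (y : ℕ → ℝ)
    (h : ∀ j ∈ s, ∀ t ∈ Set.Icc (y j) (y j + L),
      ∃ p ∈ F, p 0 ∈ Set.Icc (j * w) (j * w + w) ∧ p 1 = t) :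
    ENNReal.ofReal (s.card * (w * L)) ≤ ballCount r F *
      (ENNReal.ofReal ((2 * r) ^ 2) *
        MeasureTheory.volume (Metric.ball (0 : EuclideanSpace ℝ (Fin 2)) 1)) := by
  have hvol : MeasureTheory.volume (⋃ j ∈ s, planeBox (j * w) w (y j) L)
      = ENNReal.ofReal (s.card * (w * L)) := by
    rw [MeasureTheory.measure_biUnion_finset]
    · simp_rw [volume_planeBox hw.le]
      rw [Finset.sum_const, nsmul_eq_mul, ENNReal.ofReal_mul (Nat.cast_nonneg _),
        ENNReal.ofReal_natCast]
    -- Columns are half-open in the first coordinate, so adjacent ones do not meet.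
    · intro i _ j _ hij
      refine Set.disjoint_left.2 fun p hi hj => hij ?_
      obtain ⟨⟨hi0, hi1⟩, -⟩ := hi
      obtain ⟨⟨hj0, hj1⟩, -⟩ := hj
      have h1 : (i : ℝ) < j + 1 := by
        refine lt_of_mul_lt_mul_right ?_ hw.le
        linarith
      have h2 : (j : ℝ) < i + 1 := by
        refine lt_of_mul_lt_mul_right ?_ hw.le
        linarith
      norm_cast at h1 h2
      omega
    · exact fun j _ => measurableSet_planeBox _ _ _ _
  rw [← hvol]
  refine volume_le_ballCount_mul (hw.trans_le hwr) fun p hp => ?_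
  simp only [Set.mem_iUnion] at hp
  obtain ⟨j, hj, hp0, hp1⟩ := hp
  obtain ⟨q, hq, hq0, hq1⟩ := h j hj (p 1) hp1
  refine ⟨q, hq, (dist_le_add_abs p q).trans ?_⟩
  rw [hq1, sub_self, abs_zero, add_zero, abs_le]
  constructor <;> linarith [hp0.1, hp0.2, hq0.1, hq0.2]

theorem exists_mul_card_le_ballCount : ∃ κ : ℝ, 0 < κ ∧ ∀ {r w L : ℝ}, 0 < w → w ≤ r →
    ∀ {F : Set (EuclideanSpace ℝ (Fin 2))} (s : Finset ℕ) (y : ℕ → ℝ),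
    (∀ j ∈ s, ∀ t ∈ Set.Icc (y j) (y j + L),
      ∃ p ∈ F, p 0 ∈ Set.Icc (j * w) (j * w + w) ∧ p 1 = t) →
    ENNReal.ofReal (κ * (s.card * (w * L) / r ^ 2)) ≤ ballCount r F := by
  set V := MeasureTheory.volume (Metric.ball (0 : EuclideanSpace ℝ (Fin 2)) 1) with hV
  have hVtop : V ≠ ⊤ := MeasureTheory.measure_ball_lt_top.ne
  have hV0 : 0 < V.toReal := ENNReal.toReal_pos (Metric.measure_ball_pos _ _ one_pos).ne' hVtop
  refine ⟨(4 * V.toReal)⁻¹, by positivity, fun {r w L} hw hwr F s y h => ?_⟩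
  have hr : 0 < r := hw.trans_le hwr
  have key := card_mul_le_ballCount_mul hw hwr s y h
  rw [← hV, ← ENNReal.ofReal_toReal hVtop, ← ENNReal.ofReal_mul (by positivity)] at key
  have hK : 0 < (2 * r) ^ 2 * V.toReal := by positivity
  rw [← ENNReal.div_le_iff (by simpa using hK) ENNReal.ofReal_ne_top,
    ← ENNReal.ofReal_div_of_pos hK] at key
  convert key using 2
  field_simp
  ring

/-! ### The lower bound for the Assouad dimension. -/

theorem mem_halfCell_iff {b : ℕ} (hb : 0 < b) (m j : ℕ) (x : ℝ) :
    x ∈ halfCell b m j ↔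
      x ∈ Set.Icc (j * (((b : ℝ) ^ m)⁻¹ / 2)) (j * (((b : ℝ) ^ m)⁻¹ / 2) + ((b : ℝ) ^ m)⁻¹ / 2) := by
  have hB : (0 : ℝ) < (b : ℝ) ^ m := by positivity
  have h1 : (j : ℝ) * (((b : ℝ) ^ m)⁻¹ / 2) = j / 2 / (b : ℝ) ^ m := by field_simp
  have h2 : (j : ℝ) * (((b : ℝ) ^ m)⁻¹ / 2) + ((b : ℝ) ^ m)⁻¹ / 2 = (j + 1) / 2 / (b : ℝ) ^ m := by
    field_simp
  rw [h2, h1, halfCell, Set.mem_ofPred_eq, Set.mem_Icc, Set.mem_Icc, div_le_iff₀ hB,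
    le_div_iff₀ hB, mul_comm x]

theorem mk_mem_graphOnUnit {f : ℝ → ℝ} {x : ℝ} (hx : x ∈ Set.Icc (0 : ℝ) 1) :
    !₂[x, f x] ∈ graphOnUnit f := by
  simpa [graphOnUnit] using hx

/-- Deep inside the graph, balls of radius `R` contain `b ^ n` columns of full height that are
`b ^ (k * n)` times narrower than `R`. -/
theorem exists_ball_count {κ : ℝ} (hκ : ∀ {r w L : ℝ}, 0 < w → w ≤ r →
    ∀ {F : Set (EuclideanSpace ℝ (Fin 2))} (s : Finset ℕ) (y : ℕ → ℝ),
    (∀ j ∈ s, ∀ t ∈ Set.Icc (y j) (y j + L),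
      ∃ p ∈ F, p 0 ∈ Set.Icc (j * w) (j * w + w) ∧ p 1 = t) →
    ENNReal.ofReal (κ * (s.card * (w * L) / r ^ 2)) ≤ ballCount r F)
    {a : ℝ} (h0 : 0 < a) (h1 : a < 1) {b k : ℕ} (hb : 0 < b) (hk : 0 < k) (hab : 1 < a * b)
    {c : ℝ} {J : Finset ℕ} (hcard : J.card = b) (hJ : ∀ j ∈ J, j < b ^ k ∧ IsCopyOn a b k c j)
    (n : ℕ) : ∃ r R : ℝ, 0 < r ∧ R / r = (b : ℝ) ^ (k * n) ∧
      ∃ x ∈ graphOnUnit (takagi a b), ENNReal.ofReal (κ / 4 * ((b : ℝ) ^ n * (b : ℝ) ^ (k * n))) ≤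
        ballCount r (Metric.closedBall x R ∩ graphOnUnit (takagi a b)) := by
  -- This makes `M` so large that copies of generation `k * M + k * n` still have vertical scale `a
  -- ^ (k * M + k * n)` at least `R`.
  obtain ⟨M, hM⟩ := pow_unbounded_of_one_lt ((a ^ (k * n))⁻¹) hab
  obtain ⟨c₀, J₀, hcard₀, hJ₀⟩ := exists_family_isCopyOn hb hcard hJ M
  obtain ⟨c', J', hcard', hJ'⟩ := exists_family_isCopyOn hb hcard hJ n
  obtain ⟨j₀, hj₀⟩ : J₀.Nonempty := Finset.card_pos.1 (hcard₀ ▸ by positivity)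
  obtain ⟨i₀, hi₀⟩ : J'.Nonempty := Finset.card_pos.1 (hcard' ▸ by positivity)
  obtain ⟨hlt, hcopy⟩ := hJ₀ j₀ hj₀
  have hb' : (0 : ℝ) < b := by exact_mod_cast hb
  set R : ℝ := ((b : ℝ) ^ (k * M))⁻¹ with hR
  set r : ℝ := ((b : ℝ) ^ (k * M + k * n))⁻¹ with hr
  have hR0 : 0 < R := by positivity
  have hr0 : 0 < r := by positivity
  have hRr : R / r = (b : ℝ) ^ (k * n) := by
    rw [hR, hr, pow_add]; field_simp
  have hcell : ∀ i ∈ J', ∀ t ∈ Set.Icc (c₀ + a ^ (k * M) * c') (c₀ + a ^ (k * M) * c' + R / 2),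
      ∃ x ∈ halfCell b (k * M + k * n) (subcell (b ^ (k * n)) j₀ i),
        x ∈ halfCell b (k * M) j₀ ∧ takagi a b x = t := by
    intro i hi t ht
    obtain ⟨hi0, hi⟩ := hJ' i hi
    have hRa : R ≤ a ^ (k * M + k * n) := by
      have h2 : (a ^ (k * n))⁻¹ ≤ (a * b) ^ (k * M) :=
        hM.le.trans (pow_le_pow_right₀ hab.le (Nat.le_mul_of_pos_left M hk))
      rw [inv_le_iff_one_le_mul₀ (by positivity), mul_pow] at h2
      rw [hR, inv_le_iff_one_le_mul₀ (by positivity), pow_add]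
      linarith
    obtain ⟨x, hx, hxt⟩ := (hcopy.comp hb hi hi0).exists_eq h0 h1 hb (t := t)
      ⟨ht.1, ht.2.trans (by linarith)⟩
    obtain ⟨q, hq, hq'⟩ := exists_subcell_eq (j := j₀) hi0
    exact ⟨x, hx, halfCell_subset hb _ hq (hq' ▸ hx), hxt⟩
  obtain ⟨x₀, -, hx₀, hfx₀⟩ := hcell i₀ hi₀ (c₀ + a ^ (k * M) * c') ⟨le_rfl, by linarith⟩
  refine ⟨r, R, hr0, hRr, _, mk_mem_graphOnUnit (halfCell_subset_Icc hb hlt hx₀), ?_⟩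
  have hs : (J'.image (subcell (b ^ (k * n)) j₀)).card = b ^ n := by
    rw [Finset.card_image_of_injOn, hcard']
    exact fun i hi i' hi' h => (subcell_injOn (hJ' i hi).1 (hJ' i' hi').1 h).2
  have key := hκ (r := r) (w := r / 2) (L := R / 2) (by positivity) (by linarith)
    (F := Metric.closedBall !₂[x₀, takagi a b x₀] R ∩ graphOnUnit (takagi a b))
    (J'.image (subcell (b ^ (k * n)) j₀)) (fun _ => c₀ + a ^ (k * M) * c') <| by
      intro j hj t ht
      obtain ⟨i, hi, rfl⟩ := Finset.mem_image.1 hj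
      obtain ⟨x, hx, hx', hxt⟩ := hcell i hi t ht
      refine ⟨!₂[x, takagi a b x], ⟨?_, mk_mem_graphOnUnit (halfCell_subset_Icc hb hlt hx')⟩,
        ?_, by simpa using hxt⟩
      · rw [mem_halfCell_iff hb, ← hR] at hx' hx₀
        refine Metric.mem_closedBall.2 ((dist_le_add_abs _ _).trans ?_)
        have e1 : |x - x₀| ≤ R / 2 := by
          rw [abs_le]; constructor <;> linarith [hx'.1, hx'.2, hx₀.1, hx₀.2]
        have e2 : |takagi a b x - takagi a b x₀| ≤ R / 2 := by
          rw [abs_le]; constructor <;> linarith [ht.1, ht.2]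
        simpa using (add_le_add e1 e2).trans_eq (by ring)
      · simpa using (mem_halfCell_iff hb _ _ _).1 hx
  convert key using 2
  rw [hs, ← hRr]
  push_cast
  field_simp
  ring

theorem le_assouadDim_takagi {a : ℝ} (h0 : 0 < a) (h1 : a < 1) {b k : ℕ} (hb : 2 ≤ b) (hk : 0 < k)
    (hab : 1 < a * b) {c : ℝ} {J : Finset ℕ} (hcard : J.card = b)
    (hJ : ∀ j ∈ J, j < b ^ k ∧ IsCopyOn a b k c j) :
    ((1 + 1 / (k : ℝ) : ℝ) : EReal) ≤ assouadDim (graphOnUnit (takagi a b)) := by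
  refine le_iInf₂ fun s hs => EReal.coe_le_coe_iff.2 ?_
  obtain ⟨-, C, hC, hcover⟩ := hs
  obtain ⟨κ, hκ0, hκ⟩ := exists_mul_card_le_ballCount
  by_contra! hlt
  have hk' : (0 : ℝ) < k := by exact_mod_cast hk
  have hb1 : (1 : ℝ) < b := by exact_mod_cast hb
  have hb0 : (0 : ℝ) < b := by linarith
  have hexp : 0 < (1 + k : ℝ) - k * s := by
    have := mul_lt_mul_of_pos_left hlt hk'
    rw [mul_add, mul_one_div_cancel hk'.ne'] at this
    linarith
  have hz : 1 < (b : ℝ) ^ ((1 + k : ℝ) - k * s) := Real.one_lt_rpow hb1 hexp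
  -- The `1` in the maximum excludes `n = 0`, for which `r = R`.
  obtain ⟨n, hn⟩ := pow_unbounded_of_one_lt (max (C / (κ / 4)) 1) hz
  have hn0 : n ≠ 0 := by
    rintro rfl
    exact absurd ((le_max_right _ _).trans_lt hn) (by simp)
  obtain ⟨r, R, hr, hRr, x, hx, hle⟩ := exists_ball_count hκ h0 h1 (by omega) hk hab hcard hJ n
  have hrR : r < R := by
    rw [← one_lt_div hr, hRr]
    exact one_lt_pow₀ hb1 (Nat.mul_ne_zero hk.ne' hn0)
  have h := hle.trans (hcover R (hr.trans hrR) r hr hrR x hx)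
  rw [hRr, ENNReal.ofReal_le_ofReal_iff (by positivity)] at h
  have hn' : C / (κ / 4) < ((b : ℝ) ^ ((1 + k : ℝ) - k * s)) ^ n := (le_max_left _ _).trans_lt hn
  rw [div_lt_iff₀ (by positivity)] at hn'
  have hpow : ((b : ℝ) ^ ((1 + k : ℝ) - k * s)) ^ n * ((b : ℝ) ^ (k * n)) ^ s
      = (b : ℝ) ^ n * (b : ℝ) ^ (k * n) := by
    rw [← Real.rpow_natCast (_ ^ _) n, ← Real.rpow_natCast _ (k * n), ← Real.rpow_mul hb0.le,
      ← Real.rpow_mul hb0.le, ← Real.rpow_natCast _ n, ← Real.rpow_add hb0, ← Real.rpow_add hb0]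
    congr 1
    push_cast
    ring
  rw [← hpow] at h
  have hpos : 0 < ((b : ℝ) ^ (k * n)) ^ s := by positivity
  nlinarith [mul_lt_mul_of_pos_right hn' hpos]

/-! ### The upper box dimension. -/

theorem ballCount_anti {X : Type*} [PseudoMetricSpace X] {r r' : ℝ} (h : r ≤ r') (F : Set X) :
    ballCount r' F ≤ ballCount r F :=
  ENat.toENNReal_le.2 (Metric.externalCoveringNumber_anti (Real.toNNReal_le_toNNReal h))

/-- The Takagi function oscillates by at least `a ^ (n + 1) / 2` on every `b`-adic interval of
length `b ^ (-n)`. -/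
theorem exists_takagi_range {a : ℝ} (h0 : 0 < a) (h1 : a < 1) {b : ℕ} (hb : 2 ≤ b) (n j : ℕ) :
    ∃ y : ℝ, ∀ t ∈ Set.Icc y (y + a ^ (n + 1) / 2),
      ∃ x ∈ Set.Icc (j * ((b : ℝ) ^ n)⁻¹) (j * ((b : ℝ) ^ n)⁻¹ + ((b : ℝ) ^ n)⁻¹),
        takagi a b x = t := by
  have hb2 : (2 : ℝ) ≤ b := by exact_mod_cast hb
  have hb0 : (0 : ℝ) < b := by linarith
  obtain ⟨d, s, hS⟩ := takagiPartial_affine a (show 0 < b by omega) n (2 * j)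
  set δ : ℝ := ((b : ℝ) ^ n)⁻¹ with hδ
  have hδ0 : 0 < δ := by positivity
  -- On `[j * δ, j * δ + 2 * h]` the rescaled remainder runs through one period, vanishing at both
  -- ends and at least `a ^ (n + 1) / 2` in the middle, while `b ≥ 2` keeps this interval in a
  -- half-cell where the partial sum is affine.
  set h : ℝ := δ / b / 2 with hh
  have hh0 : 0 < h := by positivity
  have hbh : b * h = δ / 2 := by rw [hh]; field_simp
  have hδh : 2 * h ≤ δ / 2 := by nlinarith
  have hpow : (b : ℝ) ^ (n + 1) * δ = b := by rw [hδ, pow_succ]; field_simp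
  have hpowh : (b : ℝ) ^ (n + 1) * h = 1 / 2 := by
    rw [hh, ← mul_div_assoc, ← mul_div_assoc, hpow]; field_simp
  have hcell : ∀ x ∈ Set.Icc (j * δ) (j * δ + 2 * h),
      takagi a b x = d + s * x + a ^ (n + 1) * takagi a b ((b : ℝ) ^ (n + 1) * x) := by
    intro x hx
    rw [takagi_eq_partial_add h0.le h1 b x (n + 1), hS]
    rw [mem_halfCell_iff (by omega), ← hδ]
    push_cast
    constructor <;> linarith [hx.1, hx.2]
  have hc := continuous_takagi h0.le h1 b
  have e0 := hcell (j * δ) ⟨le_rfl, by linarith⟩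
  have e1 := hcell (j * δ + h) ⟨by linarith, by linarith⟩
  have e2 := hcell (j * δ + 2 * h) ⟨by linarith, by linarith⟩
  have i0 : (b : ℝ) ^ (n + 1) * (j * δ) = (b * j : ℕ) := by
    rw [mul_left_comm, hpow]; push_cast; ring
  have i1 : (b : ℝ) ^ (n + 1) * (j * δ + h) = (b * j : ℕ) + 1 / 2 := by rw [mul_add, i0, hpowh]
  have i2 : (b : ℝ) ^ (n + 1) * (j * δ + 2 * h) = (b * j + 1 : ℕ) := by
    rw [mul_add, i0, mul_left_comm, hpowh]; push_cast; ring
  rw [i0, takagi_nat] at e0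
  rw [i1] at e1
  rw [i2, takagi_nat] at e2
  have hpos : 0 < a ^ (n + 1) := by positivity
  have hbump : a ^ (n + 1) * (1 / 2) ≤ a ^ (n + 1) * takagi a b ((b * j : ℕ) + 1 / 2) :=
    mul_le_mul_of_nonneg_left (half_le_takagi h0.le h1 b _) hpos.le
  -- On the left half for `s ≥ 0`, on the right half for `s ≤ 0`, the affine part and the remainder
  -- change in the same direction, so they cannot cancel.
  rcases le_total 0 s with hs | hs
  · have hsh := mul_nonneg hs hh0.le
    refine ⟨takagi a b (j * δ), fun t ht => ?_⟩
    obtain ⟨x, hx, hxt⟩ := intermediate_value_Icc (show j * δ ≤ j * δ + h by linarith)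
      hc.continuousOn ⟨ht.1, ht.2.trans (by linarith)⟩
    exact ⟨x, ⟨hx.1, by linarith [hx.2]⟩, hxt⟩
  · have hsh := mul_nonneg (neg_nonneg.2 hs) hh0.le
    refine ⟨takagi a b (j * δ + 2 * h), fun t ht => ?_⟩
    obtain ⟨x, hx, hxt⟩ := intermediate_value_Icc'
      (show j * δ + h ≤ j * δ + 2 * h by linarith)
      hc.continuousOn ⟨ht.1, ht.2.trans (by linarith)⟩
    exact ⟨x, ⟨by linarith [hx.1], by linarith [hx.2]⟩, hxt⟩

theorem exists_mul_pow_le_ballCount {a : ℝ} (h0 : 0 < a) (h1 : a < 1) {b : ℕ} (hb : 2 ≤ b) :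
    ∃ κ : ℝ, 0 < κ ∧ ∀ n : ℕ, ENNReal.ofReal (κ * (a * b * b) ^ n) ≤
      ballCount ((b : ℝ) ^ n)⁻¹ (graphOnUnit (takagi a b)) := by
  obtain ⟨κ, hκ0, hκ⟩ := exists_mul_card_le_ballCount
  have hb0 : (0 : ℝ) < b := by exact_mod_cast (by omega : 0 < b)
  refine ⟨κ * (a / 2), by positivity, fun n => ?_⟩
  choose y hy using exists_takagi_range h0 h1 hb n
  have hδ0 : 0 < ((b : ℝ) ^ n)⁻¹ := by positivity
  have key := hκ hδ0 le_rfl (F := graphOnUnit (takagi a b)) (Finset.range (b ^ n)) y <| by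
    intro j hj t ht
    obtain ⟨x, hx, hxt⟩ := hy j t ht
    have hj' : (j : ℝ) + 1 ≤ (b : ℝ) ^ n := by exact_mod_cast Finset.mem_range.1 hj
    refine ⟨!₂[x, takagi a b x], mk_mem_graphOnUnit ⟨le_trans (by positivity) hx.1, ?_⟩,
      by simpa using hx, by simpa using hxt⟩
    calc x ≤ (j + 1) * ((b : ℝ) ^ n)⁻¹ := by linarith [hx.2]
      _ ≤ (b : ℝ) ^ n * ((b : ℝ) ^ n)⁻¹ := mul_le_mul_of_nonneg_right hj' hδ0.le
      _ = 1 := mul_inv_cancel₀ (by positivity)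
  convert key using 2
  rw [Finset.card_range, mul_pow, mul_pow, pow_succ]
  push_cast
  field_simp

theorem exists_ballCount_le_mul_pow {a : ℝ} (h0 : 0 < a) (h1 : a < 1) {b : ℕ} (hb : 2 ≤ b)
    (hab : 1 < a * b) : ∃ K : ℝ, 0 < K ∧ ∀ n : ℕ,
      ballCount (2 * ((b : ℝ) ^ n)⁻¹) (graphOnUnit (takagi a b)) ≤
        ENNReal.ofReal (K * (a * b * b) ^ n) := by
  have hb1 : (1 : ℝ) < b := by exact_mod_cast hb
  have hb0 : (0 : ℝ) < b := by linarith
  set C : ℝ := (a * b - 1)⁻¹ + (1 - a)⁻¹ with hC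
  have hC0 : 0 ≤ C := add_nonneg (inv_nonneg.2 (by linarith)) (inv_nonneg.2 (by linarith))
  refine ⟨2 * (2 * C + 5), by positivity, fun n => ?_⟩
  set δ : ℝ := ((b : ℝ) ^ n)⁻¹ with hδ
  have hB : (0 : ℝ) < (b : ℝ) ^ n := by positivity
  have hδ0 : 0 < δ := by positivity
  set H : ℕ := ⌈C * (a * b) ^ n⌉₊ with hH
  -- Above each grid point `j * δ`, a vertical stack of centres spaced by `δ`, reaching as far as
  -- the oscillation on one column; `H` is that oscillation in units of `δ`.
  set S : Finset (EuclideanSpace ℝ (Fin 2)) :=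
    (Finset.range (b ^ n + 1) ×ˢ Finset.Icc (-(H : ℤ)) H).image
      fun p => !₂[p.1 * δ, takagi a b (p.1 * δ) + p.2 * δ] with hS
  have hcover : Metric.IsCover (2 * δ).toNNReal (graphOnUnit (takagi a b)) S := by
    rw [Metric.isCover_iff_subset_iUnion_closedBall]
    rintro p ⟨⟨hp0, hp1⟩, hp⟩
    set x := p 0
    set j : ℕ := ⌊(b : ℝ) ^ n * x⌋₊
    have hj0 : (j : ℝ) ≤ (b : ℝ) ^ n * x := Nat.floor_le (by positivity)
    have hj1 : (b : ℝ) ^ n * x < j + 1 := Nat.lt_floor_add_one _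
    have hx : x = (b : ℝ) ^ n * x * δ := by rw [hδ]; field_simp
    have hxj : |x - j * δ| ≤ δ := by
      rw [abs_le]
      have := mul_le_mul_of_nonneg_right hj0 hδ0.le
      have := mul_le_mul_of_nonneg_right hj1.le hδ0.le
      constructor <;> linarith
    have hosc := abs_takagi_sub_le h0.le h1 hb0 hab n hxj
    have hq : |(takagi a b x - takagi a b (j * δ)) / δ| ≤ H := by
      rw [abs_div, abs_of_pos hδ0, div_le_iff₀ hδ0]
      refine hosc.trans ?_
      calc C * a ^ n = C * (a * b) ^ n * δ := by rw [hδ, mul_pow]; field_simp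
        _ ≤ H * δ := mul_le_mul_of_nonneg_right (Nat.le_ceil _) hδ0.le
    rw [abs_le] at hq
    set l : ℤ := ⌊(takagi a b x - takagi a b (j * δ)) / δ⌋
    have hl0 := Int.floor_le ((takagi a b x - takagi a b (j * δ)) / δ)
    have hl1 := Int.lt_floor_add_one ((takagi a b x - takagi a b (j * δ)) / δ)
    rw [le_div_iff₀ hδ0] at hl0
    rw [div_lt_iff₀ hδ0] at hl1
    simp only [Set.mem_iUnion]
    refine ⟨!₂[j * δ, takagi a b (j * δ) + l * δ], ?_, ?_⟩
    · refine Finset.mem_coe.2 (Finset.mem_image.2 ⟨(j, l), Finset.mem_product.2 ⟨?_, ?_⟩, rfl⟩)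
      · rw [Finset.mem_range, Nat.lt_succ_iff]
        have : (j : ℝ) ≤ (b : ℝ) ^ n := hj0.trans (mul_le_of_le_one_right hB.le hp1)
        exact_mod_cast this
      · rw [Finset.mem_Icc]
        refine ⟨Int.le_floor.2 (by push_cast; exact hq.1), ?_⟩
        have : (l : ℝ) ≤ H := (Int.floor_le _).trans hq.2
        exact_mod_cast this
    · rw [Metric.mem_closedBall, Real.coe_toNNReal _ (by positivity)]
      refine (dist_le_add_abs _ _).trans ?_
      have hy : |takagi a b x - (takagi a b (j * δ) + l * δ)| ≤ δ := by
        rw [abs_le]; constructor <;> linarith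
      rw [hp]
      simpa using (add_le_add hxj hy).trans_eq (by ring)
  have hle : ballCount (2 * δ) (graphOnUnit (takagi a b)) ≤ (S.card : ENNReal) := by
    have := ENat.toENNReal_le.2 hcover.externalCoveringNumber_le_encard
    rwa [Set.encard_coe_eq_coe_finsetCard, ENat.toENNReal_coe] at this
  refine hle.trans ?_
  rw [← ENNReal.ofReal_natCast]
  refine ENNReal.ofReal_le_ofReal ?_
  have hcard : S.card ≤ (b ^ n + 1) * (2 * H + 1) := by
    refine Finset.card_image_le.trans_eq ?_
    rw [Finset.card_product, Finset.card_range, Int.card_Icc]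
    congr 1
    omega
  have hcard' : (S.card : ℝ) ≤ ((b : ℝ) ^ n + 1) * (2 * H + 1) := by exact_mod_cast hcard
  have hHle : (H : ℝ) ≤ C * (a * b) ^ n + 1 := (Nat.ceil_lt_add_one (by positivity)).le
  have hP : 1 ≤ (a * b) ^ n := one_le_pow₀ hab.le
  have hB1 : 1 ≤ (b : ℝ) ^ n := one_le_pow₀ hb1.le
  calc (S.card : ℝ) ≤ ((b : ℝ) ^ n + 1) * (2 * H + 1) := hcard'
    _ ≤ (2 * (b : ℝ) ^ n) * ((2 * C + 5) * (a * b) ^ n) := by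
        refine mul_le_mul (by linarith) (by linarith) (by positivity) (by positivity)
    _ = _ := by rw [mul_pow (a * b)]; ring

theorem upperBoxDim_takagi {a : ℝ} (h0 : 0 < a) (h1 : a < 1) {b : ℕ} (hb : 2 ≤ b)
    (hab : 1 < a * b) : upperBoxDim (graphOnUnit (takagi a b)) =
      ((1 + Real.log (a * b) / Real.log b : ℝ) : EReal) := by
  have hb1 : (1 : ℝ) < b := by exact_mod_cast hb
  have hb0 : (0 : ℝ) < b := by linarith
  have hlogb : 0 < Real.log b := Real.log_pos hb1
  have hlogab : 0 < Real.log (a * b) := Real.log_pos hab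
  set D : ℝ := 1 + Real.log (a * b) / Real.log b with hD
  have hD0 : 0 ≤ D := by positivity
  have hbD : (b : ℝ) ^ D = a * b * b := by
    rw [hD, Real.rpow_add hb0, Real.rpow_one, Real.rpow_def_of_pos hb0,
      mul_div_cancel₀ _ hlogb.ne', Real.exp_log (by linarith)]
    ring
  apply le_antisymm
  · obtain ⟨K, hK, hcount⟩ := exists_ballCount_le_mul_pow h0 h1 hb hab
    set K' : ℝ := K * (2 * b) ^ D with hK'
    have hK'0 : 0 < K' := by positivity
    have hscale : ∀ r : ℝ, 0 < r → r < 1 →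
        ballCount r (graphOnUnit (takagi a b)) ≤ ENNReal.ofReal (K' * r ^ (-D)) := by
      intro r hr hr1
      -- Sandwiching `2 / r` between consecutive powers of `b` costs only the constant factor `(2 *
      -- b) ^ D`.
      obtain ⟨n, hn0, hn1⟩ := exists_nat_pow_near
        (show (1 : ℝ) ≤ 2 / r by rw [le_div_iff₀ hr]; linarith) hb1
      have hr' : 2 * ((b : ℝ) ^ (n + 1))⁻¹ ≤ r := by
        rw [div_lt_iff₀ hr] at hn1
        rw [← div_eq_mul_inv, div_le_iff₀ (by positivity)]
        linarith
      refine ((ballCount_anti hr' _).trans (hcount (n + 1))).trans (ENNReal.ofReal_le_ofReal ?_)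
      have hpow : (a * b * b) ^ (n + 1) ≤ (2 * b / r) ^ D := by
        rw [← hbD, ← Real.rpow_natCast, ← Real.rpow_mul hb0.le, mul_comm D, Real.rpow_mul hb0.le,
          Real.rpow_natCast]
        refine Real.rpow_le_rpow (by positivity) ?_ hD0
        rw [pow_succ, mul_div_right_comm]
        exact mul_le_mul_of_nonneg_right hn0 hb0.le
      calc K * (a * b * b) ^ (n + 1) ≤ K * (2 * b / r) ^ D := mul_le_mul_of_nonneg_left hpow hK.le
        _ = K' * r ^ (-D) := by
          rw [Real.div_rpow (by positivity) hr.le, Real.rpow_neg hr.le, hK']; ring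
    have hlim : Tendsto (fun r : ℝ => ((Real.log K' / (-Real.log r) + D : ℝ) : EReal)) (𝓝[>] 0)
        (𝓝 (D : EReal)) := by
      refine EReal.tendsto_coe.2 ?_
      have := (tendsto_neg_atBot_atTop.comp Real.tendsto_log_nhdsGT_zero).const_div_atTop
        (Real.log K')
      simpa using this.add_const D
    rw [← hlim.limsup_eq]
    refine limsup_le_limsup ?_
    filter_upwards [Ioo_mem_nhdsGT (zero_lt_one' ℝ)] with r hr
    have hlog : 0 < -Real.log r := neg_pos.2 (Real.log_neg hr.1 hr.2)
    have hlog0 : Real.log r ≠ 0 := (neg_pos.1 hlog).ne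
    have hpos : 0 < r ^ (-D) := Real.rpow_pos_of_pos hr.1 _
    have h := ENNReal.log_le_log (hscale r hr.1 hr.2)
    rw [ENNReal.log_ofReal_of_pos (by positivity)] at h
    refine (EReal.div_le_div_right_of_nonneg (EReal.coe_nonneg.2 hlog.le) h).trans_eq ?_
    rw [← EReal.coe_div, Real.log_mul hK'0.ne' hpos.ne', Real.log_rpow hr.1]
    congr 1
    field_simp
    ring
  · obtain ⟨κ, hκ, hcount⟩ := exists_mul_pow_le_ballCount h0 h1 hb
    -- For a lower bound on the upper limit, the radii `b ^ (-n)` suffice.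
    have hu : Tendsto (fun n : ℕ => ((b : ℝ) ^ n)⁻¹) atTop (𝓝[>] 0) :=
      tendsto_inv_atTop_nhdsGT_zero.comp (tendsto_pow_atTop_atTop_of_one_lt hb1)
    have hlim : Tendsto (fun n : ℕ => ((Real.log κ / (n * Real.log b) + D : ℝ) : EReal)) atTop
        (𝓝 (D : EReal)) := by
      refine EReal.tendsto_coe.2 ?_
      have := (tendsto_natCast_atTop_atTop.atTop_mul_const hlogb).const_div_atTop (Real.log κ)
      simpa using this.add_const D
    rw [← hlim.limsup_eq]
    refine le_trans ?_ (limsup_le_limsup_of_le hu)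
    rw [limsup, limsup, map_map]
    refine limsup_le_limsup (f := atTop) ?_
    filter_upwards [eventually_gt_atTop 0] with n hn
    have hn' : (0 : ℝ) < n := by exact_mod_cast hn
    have h := ENNReal.log_le_log (hcount n)
    rw [ENNReal.log_ofReal_of_pos (by positivity)] at h
    have hlog : -Real.log ((b : ℝ) ^ n)⁻¹ = n * Real.log b := by
      rw [Real.log_inv, neg_neg, Real.log_pow]
    simp only [Function.comp_apply, hlog]
    refine le_of_eq_of_le ?_
      (EReal.div_le_div_right_of_nonneg (EReal.coe_nonneg.2 (by positivity)) h)
    rw [← EReal.coe_div, Real.log_mul hκ.ne' (by positivity), ← hbD, ← Real.rpow_natCast,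
      Real.log_rpow (by positivity), Real.log_rpow hb0]
    congr 1
    field_simp

/-! ### Littlewood roots and the main theorem. -/

theorem IsLittlewood.exists_signs {p : Polynomial ℤ} (hp : IsLittlewood p) {β : ℝ}
    (hroot : Polynomial.aeval β p = 0) : ∃ ε : ℕ → ℝ, ε 0 = 1 ∧ (∀ i, ε i = 1 ∨ ε i = -1) ∧
      ∑ i ∈ Finset.range (p.natDegree + 1), ε i * β ^ i = 0 := by
  have hcoeff : ∀ i ≤ p.natDegree, (p.coeff i : ℝ) = 1 ∨ (p.coeff i : ℝ) = -1 := fun i hi => by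
    exact_mod_cast hp i hi
  have h0 := hcoeff 0 (Nat.zero_le _)
  -- Multiplying by the constant coefficient, itself a sign, normalises the first sign to `1`, the
  -- slope on `[0, 1 / 2]`; beyond the degree the value `1` is a filler.
  refine ⟨fun i => if i ≤ p.natDegree then p.coeff 0 * p.coeff i else 1, ?_, fun i => ?_, ?_⟩
  · rcases h0 with h | h <;> simp [h]
  · dsimp only
    split_ifs with hi
    · rcases h0 with h | h <;> rcases hcoeff i hi with h' | h' <;> simp [h, h']
    · exact Or.inl rfl
  · rw [Polynomial.aeval_eq_sum_range] at hroot
    calc _ = p.coeff 0 * ∑ i ∈ Finset.range (p.natDegree + 1), p.coeff i • β ^ i := by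
          rw [Finset.mul_sum]
          refine Finset.sum_congr rfl fun i hi => ?_
          dsimp only
          rw [if_pos (Nat.lt_succ_iff.1 (Finset.mem_range.1 hi)), zsmul_eq_mul, mul_assoc]
      _ = 0 := by rw [hroot, mul_zero]

theorem theorem1p1 (p : Polynomial ℤ) (hp : IsLittlewood p) (k : ℕ) (hk : p.natDegree + 1 = k)
    (β : ℝ) (hβ : 1 < β) (hroot : Polynomial.aeval β p = 0) :
    (∀ (a : ℝ) (b : ℕ), a < 1 → 2 < b → a * b = β →
      ((1 + 1 / (k : ℝ) : ℝ) : EReal) ≤ assouadDim (graphOnUnit (takagi a b)) ∧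
      upperBoxDim (graphOnUnit (takagi a b)) =
        ((1 + Real.log (a * b) / Real.log b : ℝ) : EReal)) ∧
    (∀ᶠ b : ℕ in atTop, ∀ a : ℝ, a < 1 → a * b = β →
      upperBoxDim (graphOnUnit (takagi a b)) < ((1 + 1 / (k : ℝ) : ℝ) : EReal)) := by
  have ha0 {a : ℝ} {b : ℕ} (hab : a * b = β) : 0 < a :=
    pos_of_mul_pos_left (by linarith) (Nat.cast_nonneg b)
  constructor
  · intro a b ha hb hab
    subst hab hk
    obtain ⟨ε, hε0, hε, hsum⟩ := hp.exists_signs hroot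
    obtain ⟨c, J, hcard, hJ⟩ := exists_isCopyOn (ha0 rfl).le ha hb.le hε0 hε hsum
    exact ⟨le_assouadDim_takagi (ha0 rfl) ha hb.le (Nat.succ_pos _) hβ hcard hJ,
      upperBoxDim_takagi (ha0 rfl) ha hb.le hβ⟩
  · filter_upwards [eventually_ge_atTop 2,
      tendsto_natCast_atTop_atTop.eventually_gt_atTop (β ^ k)] with b hb hbk a ha hab
    have hk0 : (0 : ℝ) < k := by exact_mod_cast (by omega : 0 < k)
    have hlogb : 0 < Real.log b := Real.log_pos (by exact_mod_cast hb)
    rw [upperBoxDim_takagi (ha0 hab) ha hb (hab ▸ hβ), hab, EReal.coe_lt_coe_iff, add_lt_add_iff_left,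
      div_lt_div_iff₀ hlogb hk0, one_mul, mul_comm, ← Real.log_pow]
    exact Real.log_lt_log (by positivity) hbk
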